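/- \textbf{Setting.} A probability density on $\mathbb{Z}_{\ge 0}$ is a function $f\ge 0$ with $\sum_{k\ge0} f(k)=1$; its cdf is $F(k)=\sum_{t=0}^k f(t)$. Graphs are finite and undirected, with loops and multiple edges allowed; $G_n$ has $n$ vertices and degrees $D_1,\dots,D_n$ (a loop counts twice), and $L_n=\sum_i D_i$. Put \[ f_n(k)=\frac1n\sum_{i=1}^n \mathbf 1\{D_i=k\},\qquad f_n^*(k)=\frac1{L_n}\sum_{i=1}^n k\,\mathbf 1\{D_i=k\}, \] with cdfs $F_n$, $F_n^*$ (where $F_n^*(-1)=0$), and $\mathcal F_n^*(k)=F_n^*(k)+F_n^*(k-1)$. Replacing each edge $i-j$ by the two directed edges $i\to j$ and $j\to i$, define \[ \widetilde\rho(G_n)=\frac{3}{L_n}\sum_{i\to j}\mathcal F_n^*(D_i)\,\mathcal F_n^*(D_j)-3 . \] For $\eta,\varepsilon>0$ and probability densities $f,f^*$ on $\mathbb{Z}_{\ge0}$, a sequence of random graphs $(G_n)$ belongs to $\mathcal G_{\eta,\varepsilon}(f,f^*)$ if $\sum_k k^{1+\eta}f(k)<\infty$ and $\mathbb P(\Omega_n)\to1$,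 where \[ \Omega_n=\Big\{\max\Big\{\sum_{k\ge0}|F_n(k)-F(k)|,\ \sum_{k\ge0}|f_n^*(k)-f^*(k)|\Big\}\le n^{-\varepsilon}\Big\}. \] \textbf{Theorem.} Let $f$ be a probability density on the non-negative integers with unbounded support (i.e. $F(k)<1$ for all $k$), mean $\mu$, and $\sum_{k\ge 0} k^{1+\eta}f(k)<\infty$ for some $\eta>0$. Then for every $-1<\rho<0$ there is a probability density $f_\rho$ on the non-negative integers, with cdf $F_\rho$, mean $0<\mu_\rho<\infty$ and $\sum_{k\ge0}k^{1+\eta}f_\rho(k)<\infty$, such that \[ \lim_{k\to\infty}\frac{1-F_\rho(k)}{1-F(k)}=\frac{\mu_\rho}{\mu}. \] Moreover, with $f_\rho^*(k)=k f_\rho(k)/\mu_\rho$, for every $\varepsilon>0$ and every sequence of random graphs $(G_n)\in\mathcal G_{\eta,\varepsilon}(f_\rho,f_\rho^*)$, \[ \mathbb P\big(\widetilde\rho(G_n)>\rho\big)\ \ge\ 1-O\big(n^{-1+\kappa}+n^{-\varepsilon+3\kappa/4}+\mathbb P(\Omega_n^c)\big)\qquad (n\to\infty), \] where $\kappa=\min(\varepsilon,1/2)$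 and $\Omega_n$ is the event above for the pair $(f_\rho,f_\rho^*)$. -/

import Mathlib

open Filter Topology MeasureTheory

namespace DegreeCorrelation

noncomputable section

/-- `f` is a probability density (mass) function on the non-negative integers. -/
structure IsDensity (f : ℕ → ℝ) : Prop where
  nonneg : ∀ k, 0 ≤ f k
  hasSum_one : HasSum f 1

/-- The cumulative distribution function `F(k) = ∑_{t ≤ k} f(t)`. -/
def cdf (f : ℕ → ℝ) (k : ℕ) : ℝ := ∑ t ∈ Finset.range (k + 1), f t

/-- The function `𝓕(k) = F(k) + F(k - 1)`, where `F(-1) = 0`. -/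
def symCdf (f : ℕ → ℝ) (k : ℕ) : ℝ :=
  ∑ t ∈ Finset.range (k + 1), f t + ∑ t ∈ Finset.range k, f t

/-- The size-biased density `f^*(k) = k f(k) / μ` of a density `f` with mean `μ`. -/
def sizeBiased (f : ℕ → ℝ) (μ : ℝ) (k : ℕ) : ℝ := k * f k / μ

/-! ### Degree sequences -/

section DegreeSequence

variable {n : ℕ}

/-- `L_n`, the sum of the degrees. -/
def totalDegree (D : Fin n → ℕ) : ℕ := ∑ i, D i

/-- The empirical degree density `f_n(k) = (1/n) ∑_i 1{D_i = k}`. -/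
def empDensity (D : Fin n → ℕ) (k : ℕ) : ℝ :=
  (∑ i, if D i = k then (1 : ℝ) else 0) / n

/-- The empirical size-biased degree density `f_n^*(k) = (1/L_n) ∑_i k 1{D_i = k}`. -/
def empSizeBiased (D : Fin n → ℕ) (k : ℕ) : ℝ :=
  (∑ i, if D i = k then (k : ℝ) else 0) / totalDegree D

/-- The condition defining the event `Ω_n`:
`max {∑_k |F_n(k) - F(k)|, ∑_k |f_n^*(k) - f^*(k)|} ≤ n^{-ε}`.
The sums are taken in `[0, ∞]`, so that a divergent sum is `∞`. -/
def IsClose (ε : ℝ) (f fs : ℕ → ℝ) (D : Fin n → ℕ) : Prop :=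
  max (∑' k, ENNReal.ofReal |cdf (empDensity D) k - cdf f k|)
      (∑' k, ENNReal.ofReal |empSizeBiased D k - fs k|)
    ≤ ENNReal.ofReal ((n : ℝ) ^ (-ε))

end DegreeSequence

/-! ### Graphs -/

/-- An undirected graph on the vertex set `{1, …, n}`, with loops and multiple edges allowed,
given by its adjacency matrix: `arcs i j` is the number of directed edges `i → j` in the
bi-directed version, in which each edge `i - j` is replaced by `i → j` and `j → i`
(so that a loop at `i` contributes two directed edges `i → i`). -/
@[ext]
structure Multigraph (n : ℕ) where
  arcs : Fin n → Fin n → ℕ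
  symm : ∀ i j, arcs i j = arcs j i
  even_loops : ∀ i, Even (arcs i i)

/-- There are countably many multigraphs on `n` vertices; every set of them is measurable. -/
instance (n : ℕ) : MeasurableSpace (Multigraph n) := ⊤

namespace Multigraph

variable {n : ℕ}

/-- The degree sequence of a multigraph (a loop counts twice). -/
def degree (G : Multigraph n) (i : Fin n) : ℕ := ∑ j, G.arcs i j

/-- Spearman's rho on a graph,
`ρ̃(G) = (3 / L_n) ∑_{i → j} 𝓕_n^*(D_i) 𝓕_n^*(D_j) - 3`,
the sum being over the directed edges, with multiplicity, of the bi-directed version. -/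
def spearman (G : Multigraph n) : ℝ :=
  3 / (totalDegree G.degree : ℝ) *
    (∑ i, ∑ j, (G.arcs i j : ℝ) *
      (symCdf (empSizeBiased G.degree) (G.degree i) *
        symCdf (empSizeBiased G.degree) (G.degree j))) - 3

end Multigraph

/-! ### Random degree sequences and random graphs with a limiting degree density -/

section Random

universe u

variable {S : ℕ → Type u} [∀ n, MeasurableSpace (S n)]

/-- The event `Ω_n` for a random degree sequence `D_n`. -/
def closeEvent (ε : ℝ) (f fs : ℕ → ℝ) {n : ℕ} (D : S n → Fin n → ℕ) : Set (S n) :=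
  {s | IsClose ε f fs (D s)}

/-- The class `𝒟_{η,ε}(f, f^*)` of sequences of random degree sequences: `D_n` has length `n` and
lives on a probability space `(S n, P n)`. -/
structure InDegreeClass (η ε : ℝ) (f fs : ℕ → ℝ) (P : ∀ n, Measure (S n))
    (D : ∀ n, S n → Fin n → ℕ) : Prop where
  eta_pos : 0 < η
  eps_pos : 0 < ε
  density : IsDensity f
  density_sizeBiased : IsDensity fs
  moment : Summable fun k : ℕ => (k : ℝ) ^ (1 + η) * f k
  tendsto_one : Tendsto (fun n => (P n).real (closeEvent ε f fs (D n))) atTop (𝓝 1)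

/-- The class `𝒢_{η,ε}(f, f^*)` of sequences of random graphs whose degree sequences belong
to `𝒟_{η,ε}(f, f^*)`. -/
def InGraphClass (η ε : ℝ) (f fs : ℕ → ℝ) (P : ∀ n, Measure (S n))
    (G : ∀ n, S n → Multigraph n) : Prop :=
  InDegreeClass η ε f fs P (fun n s => (G n s).degree)

end Random

end

end DegreeCorrelation

namespace DegreeCorrelation

/-! Write `p` for the empirical size-biased density and `g` for `symCdf p`. Under `p`, `g` has mean
1 and second moment `(4 - ∑ p ^ 3) / 3`. Nonnegativity of the sum of `(g i + g j - 2) ^ 2` over the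
directed edges then bounds Spearman's rho below by `∑ p ^ 3 - 1`, whatever the wiring
(`cube_sub_one_le_spearman`). One large atom of the size-biased density thus rules out strongly
negative values. `concentrate` creates it at degree 1 and leaves the tail of `f` intact up to a
factor. On `Ω_n` the bound is deterministic for large `n`, so the exceptional probability is at most
that of `Ω_nᶜ`. -/

lemma sum_mul_symCdf (p : ℕ → ℝ) (N : ℕ) :
    ∑ k ∈ Finset.range N, p k * symCdf p k = (∑ k ∈ Finset.range N, p k) ^ 2 := by
  induction N with
  | zero => simp
  | succ N ih =>
    rw [Finset.sum_range_succ, ih]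
    simp only [symCdf, Finset.sum_range_succ]
    ring

/-- Telescoping: for consecutive partial sums `a`, `b`, the identity is `3 (b - a) (a + b)² = 4 (b³
- a³) - (b - a)³`. -/
lemma sum_mul_symCdf_sq (p : ℕ → ℝ) (N : ℕ) :
    3 * ∑ k ∈ Finset.range N, p k * symCdf p k ^ 2 =
      4 * (∑ k ∈ Finset.range N, p k) ^ 3 - ∑ k ∈ Finset.range N, p k ^ 3 := by
  induction N with
  | zero => simp
  | succ N ih =>
    rw [Finset.sum_range_succ, mul_add, ih]
    simp only [symCdf, Finset.sum_range_succ]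
    ring

section DegreeSequence

variable {n : ℕ}

lemma empSizeBiased_nonneg (D : Fin n → ℕ) (k : ℕ) : 0 ≤ empSizeBiased D k := by
  unfold empSizeBiased
  refine div_nonneg (Finset.sum_nonneg fun i _ => ?_) (Nat.cast_nonneg _)
  split_ifs <;> positivity

/-- Integrating a function against the empirical size-biased density. -/
lemma sum_empSizeBiased_mul (D : Fin n → ℕ) (g : ℕ → ℝ) {N : ℕ} (hN : ∀ i, D i < N) :
    ∑ k ∈ Finset.range N, empSizeBiased D k * g k =
      (∑ i, (D i : ℝ) * g (D i)) / totalDegree D := by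
  simp only [empSizeBiased, div_mul_eq_mul_div, ← Finset.sum_div, Finset.sum_mul]
  rw [Finset.sum_comm]
  congr 1
  refine Finset.sum_congr rfl fun i _ => ?_
  simp [ite_mul, Finset.sum_ite_eq, hN i]

lemma sum_empSizeBiased (D : Fin n → ℕ) {N : ℕ} (hN : ∀ i, D i < N) (hD : totalDegree D ≠ 0) :
    ∑ k ∈ Finset.range N, empSizeBiased D k = 1 := by
  have h := sum_empSizeBiased_mul D (fun _ => 1) hN
  simp only [mul_one] at h
  rw [h, ← Nat.cast_sum]
  exact div_self (Nat.cast_ne_zero.2 hD)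

end DegreeSequence

/-! ### Lower bound for Spearman's rho of an arbitrary graph. -/

namespace Multigraph

variable {n : ℕ}

lemma sum_arcs (G : Multigraph n) (i : Fin n) : ∑ j, (G.arcs i j : ℝ) = G.degree i := by
  simp [degree]

lemma sum_arcs_mul_left (G : Multigraph n) (g : Fin n → ℝ) :
    ∑ i, ∑ j, (G.arcs i j : ℝ) * g i = ∑ i, (G.degree i : ℝ) * g i := by
  simp only [← Finset.sum_mul, sum_arcs]

lemma sum_arcs_mul_right (G : Multigraph n) (g : Fin n → ℝ) :
    ∑ i, ∑ j, (G.arcs i j : ℝ) * g j = ∑ i, (G.degree i : ℝ) * g i := by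
  rw [Finset.sum_comm, ← sum_arcs_mul_left]
  simp only [fun i j => G.symm i j]

/-- The sum of products over the directed edges, bounded below by the degree-weighted variance
around a constant. -/
lemma le_sum_arcs_mul (G : Multigraph n) (g : Fin n → ℝ) :
    2 * ∑ i, (G.degree i : ℝ) * g i - ∑ i, (G.degree i : ℝ) * g i ^ 2 +
      2 * (∑ i, (G.degree i : ℝ) * g i - ∑ i, (G.degree i : ℝ)) ≤
      ∑ i, ∑ j, (G.arcs i j : ℝ) * (g i * g j) := by
  -- Each endpoint is centred at 1, the degree-weighted mean of `g` in the application.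
  have key : (0 : ℝ) ≤ ∑ i, ∑ j, (G.arcs i j : ℝ) * (g i + g j - 2) ^ 2 :=
    Finset.sum_nonneg fun i _ => Finset.sum_nonneg fun j _ => by positivity
  have expand : ∑ i, ∑ j, (G.arcs i j : ℝ) * (g i + g j - 2) ^ 2 =
      ∑ i, ∑ j, (G.arcs i j : ℝ) * g i ^ 2 + ∑ i, ∑ j, (G.arcs i j : ℝ) * g j ^ 2 +
        2 * ∑ i, ∑ j, (G.arcs i j : ℝ) * (g i * g j) +
        4 * ∑ i, ∑ j, (G.arcs i j : ℝ) * 1 - 4 * ∑ i, ∑ j, (G.arcs i j : ℝ) * g i -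
        4 * ∑ i, ∑ j, (G.arcs i j : ℝ) * g j := by
    simp only [Finset.mul_sum, ← Finset.sum_add_distrib, ← Finset.sum_sub_distrib]
    exact Finset.sum_congr rfl fun i _ => Finset.sum_congr rfl fun j _ => by ring
  rw [expand, sum_arcs_mul_left G (fun i => g i ^ 2), sum_arcs_mul_right G (fun i => g i ^ 2),
    sum_arcs_mul_left G g, sum_arcs_mul_right G g, sum_arcs_mul_left G (fun _ => 1)] at key
  simp only [mul_one] at key
  linarith

/-- Spearman's rho of a graph is at least `∑ k, f_n^*(k) ^ 3 - 1`; here for a single atom. -/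
lemma cube_sub_one_le_spearman (G : Multigraph n) (hG : totalDegree G.degree ≠ 0) (k : ℕ) :
    empSizeBiased G.degree k ^ 3 - 1 ≤ G.spearman := by
  set p := empSizeBiased G.degree with hp
  set N := k + totalDegree G.degree + 1 with hN
  have hlt : ∀ i, G.degree i < N := fun i => by
    -- `N` exceeds every degree and `k`, so the sums over `range N` see all the mass and the chosen
    -- atom.
    have : G.degree i ≤ totalDegree G.degree :=
      Finset.single_le_sum (f := G.degree) (fun _ _ => Nat.zero_le _) (Finset.mem_univ i)
    omega
  have hL : (0 : ℝ) < totalDegree G.degree := by exact_mod_cast Nat.pos_of_ne_zero hG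
  have hone : ∑ k ∈ Finset.range N, p k = 1 := sum_empSizeBiased _ hlt hG
  have hfirst := sum_mul_symCdf p N
  have hsecond := sum_mul_symCdf_sq p N
  rw [hone, hp, sum_empSizeBiased_mul _ _ hlt, ← hp] at hfirst
  rw [hone, hp, sum_empSizeBiased_mul _ (fun k => symCdf p k ^ 2) hlt, ← hp] at hsecond
  have hatom : p k ^ 3 ≤ ∑ k ∈ Finset.range N, p k ^ 3 :=
    Finset.single_le_sum (f := fun k => p k ^ 3)
      (fun k _ => pow_nonneg (empSizeBiased_nonneg _ _) 3) (Finset.mem_range.2 (by omega))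
  have hbound := G.le_sum_arcs_mul fun i => symCdf p (G.degree i)
  have hdeg : ∑ i, (G.degree i : ℝ) = totalDegree G.degree := by simp [totalDegree]
  rw [div_eq_iff hL.ne'] at hfirst
  simp only [hfirst, hdeg] at hbound
  have hdiv := div_le_div_of_nonneg_right hbound hL.le
  unfold spearman
  rw [← hp, div_mul_eq_mul_div, mul_div_assoc]
  have hsplit : (2 * (1 ^ 2 * (totalDegree G.degree : ℝ)) -
      ∑ i, (G.degree i : ℝ) * symCdf p (G.degree i) ^ 2 +
        2 * (1 ^ 2 * (totalDegree G.degree : ℝ) - totalDegree G.degree)) / totalDegree G.degree =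
      2 - (∑ i, (G.degree i : ℝ) * symCdf p (G.degree i) ^ 2) / totalDegree G.degree := by
    field_simp
    ring
  rw [hsplit] at hdiv
  linarith

end Multigraph

/-- A close degree sequence has size-biased empirical density pointwise close to the limit. -/
lemma IsClose.abs_sub_le {n : ℕ} {ε : ℝ} {f fs : ℕ → ℝ} {D : Fin n → ℕ} (h : IsClose ε f fs D)
    (k : ℕ) : |empSizeBiased D k - fs k| ≤ (n : ℝ) ^ (-ε) := by
  have h1 := (ENNReal.le_tsum k).trans ((le_max_right _ _).trans h)
  exact (ENNReal.ofReal_le_ofReal_iff (by positivity)).1 h1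

/-- If a limiting size-biased density has an atom of mass `p` with `1 + ρ < p ^ 3`, then on the
event `Ω_n` Spearman's rho exceeds `ρ` for all large `n`. -/
lemma eventually_lt_spearman_of_isClose {f fs : ℕ → ℝ} {ρ ε : ℝ} (hε : 0 < ε) {k : ℕ}
    (hρ : -1 < ρ) (hk : 1 + ρ < fs k ^ 3) :
    ∀ᶠ n : ℕ in atTop, ∀ G : Multigraph n, IsClose ε f fs G.degree → ρ < G.spearman := by
  have hlim : Tendsto (fun n : ℕ => (fs k - (n : ℝ) ^ (-ε)) ^ 3) atTop (𝓝 ((fs k - 0) ^ 3)) :=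
    (((tendsto_rpow_neg_atTop hε).comp tendsto_natCast_atTop_atTop).const_sub (fs k)).pow 3
  rw [sub_zero] at hlim
  filter_upwards [hlim.eventually (lt_mem_nhds hk)] with n hn G hG
  have hle : fs k - (n : ℝ) ^ (-ε) ≤ empSizeBiased G.degree k := by
    linarith [(abs_le.1 (hG.abs_sub_le k)).1]
  have hcube : 1 + ρ < empSizeBiased G.degree k ^ 3 :=
    hn.trans_le ((show Odd 3 by decide).pow_le_pow.2 hle)
  -- With no edges, division by zero makes `empSizeBiased` vanish, which contradicts `-1 < ρ`.
  have hL : totalDegree G.degree ≠ 0 := fun h0 => by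
    rw [empSizeBiased, h0, Nat.cast_zero, div_zero] at hcube
    norm_num at hcube
    linarith
  linarith [G.cube_sub_one_le_spearman hL k]

/-! ### Moving the mass of the size-biased density below a threshold to `1` -/

noncomputable section

lemma hasSum_ite_lt {g : ℕ → ℝ} {s : ℝ} (hg : HasSum g s) (K : ℕ) :
    HasSum (fun k => if K < k then g k else 0) (s - ∑ k ∈ Finset.range (K + 1), g k) := by
  have hfin : HasSum (fun k => if k ∈ Finset.range (K + 1) then g k else 0)
      (∑ k ∈ Finset.range (K + 1), g k) := by
    rw [← Finset.sum_congr rfl fun k hk => if_pos (c := k ∈ Finset.range (K + 1)) hk]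
    exact hasSum_sum_of_ne_finset_zero fun k hk => if_neg hk
  refine (hg.sub hfin).congr_fun ?_
  intro k
  simp only [Finset.mem_range]
  split_ifs <;> first | omega | simp

/-- The partial mean `∑_{k ≤ K} k f(k)`. -/
def partialMean (f : ℕ → ℝ) (K : ℕ) : ℝ := ∑ k ∈ Finset.range (K + 1), (k : ℝ) * f k

/-- The normalising constant of `concentrate`. -/
def concentrateScale (f : ℕ → ℝ) (K : ℕ) : ℝ := (1 - cdf f K + partialMean f K)⁻¹

/-- The density whose size-biased density agrees with that of `f` above `K`, and has all its
remaining mass at `1`. -/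
def concentrate (f : ℕ → ℝ) (K : ℕ) (k : ℕ) : ℝ :=
  concentrateScale f K * ((if K < k then f k else 0) + if k = 1 then partialMean f K else 0)

variable {f : ℕ → ℝ}

lemma partialMean_nonneg (hf : IsDensity f) (K : ℕ) : 0 ≤ partialMean f K :=
  Finset.sum_nonneg fun k _ => mul_nonneg k.cast_nonneg (hf.nonneg k)

lemma concentrateScale_pos (hf : IsDensity f) {K : ℕ} (hK : cdf f K < 1) :
    0 < concentrateScale f K :=
  inv_pos.2 (by linarith [partialMean_nonneg hf K])

lemma isDensity_concentrate (hf : IsDensity f) {K : ℕ} (hK : cdf f K < 1) :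
    IsDensity (concentrate f K) where
  nonneg k := by
    refine mul_nonneg (concentrateScale_pos hf hK).le (add_nonneg ?_ ?_)
    · split_ifs; exacts [hf.nonneg k, le_rfl]
    · split_ifs; exacts [partialMean_nonneg hf K, le_rfl]
  hasSum_one := by
    have h := ((hasSum_ite_lt hf.hasSum_one K).add
      (hasSum_ite_eq 1 (partialMean f K))).mul_left (concentrateScale f K)
    have hpos := inv_pos.1 (concentrateScale_pos hf hK)
    rwa [← cdf, show concentrateScale f K * _ = 1 from inv_mul_cancel₀ hpos.ne'] at h

/-- An atom at 1 contributes its own weight to the mean, so `partialMean f K` placed there exactly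
replaces what was removed. -/
lemma hasSum_mul_concentrate {μ : ℝ} (hμ : HasSum (fun k : ℕ => (k : ℝ) * f k) μ) (K : ℕ) :
    HasSum (fun k : ℕ => (k : ℝ) * concentrate f K k) (concentrateScale f K * μ) := by
  have h := ((hasSum_ite_lt hμ K).add
    (hasSum_ite_eq 1 (partialMean f K))).mul_left (concentrateScale f K)
  rw [← partialMean, sub_add_cancel] at h
  refine h.congr_fun fun k => ?_
  unfold concentrate
  rcases eq_or_ne k 1 with rfl | hk
  · simp
  · simp only [hk, if_false, add_zero]
    split_ifs <;> ring

lemma summable_rpow_mul_concentrate {a : ℝ}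
    (hf : Summable fun k : ℕ => (k : ℝ) ^ a * f k) (K : ℕ) :
    Summable fun k : ℕ => (k : ℝ) ^ a * concentrate f K k := by
  have h := (((hasSum_ite_lt hf.hasSum K).add
    (hasSum_ite_eq 1 (partialMean f K))).mul_left (concentrateScale f K)).summable
  refine h.congr fun k => ?_
  unfold concentrate
  rcases eq_or_ne k 1 with rfl | hk
  · simp
  · simp only [hk, if_false, add_zero]
    split_ifs <;> ring

/-- The densities are proportional above `K`, and the normalisation makes the tails agree at `K`;
hence the tail ratio is constant, not merely convergent. -/
lemma one_sub_cdf_concentrate (hf : IsDensity f) {K : ℕ} (hK : cdf f K < 1) (hK1 : 1 ≤ K) {k : ℕ}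
    (hk : K ≤ k) : 1 - cdf (concentrate f K) k = concentrateScale f K * (1 - cdf f k) := by
  have hpos := inv_pos.1 (concentrateScale_pos hf hK)
  induction k, hk using Nat.le_induction with
  | base =>
    have h : cdf (concentrate f K) K = concentrateScale f K * partialMean f K := by
      unfold cdf
      rw [Finset.sum_eq_single_of_mem 1 (Finset.mem_range.2 (by omega))]
      · simp [concentrate, not_lt.2 hK1]
      · intro t ht ht1
        have : ¬ K < t := by have := Finset.mem_range.1 ht; omega
        simp [concentrate, this, ht1]
    rw [h, concentrateScale]
    field_simp
    ring
  | succ k hk ih =>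
    have h1 : cdf (concentrate f K) (k + 1) =
        cdf (concentrate f K) k + concentrateScale f K * f (k + 1) := by
      rw [cdf, Finset.sum_range_succ, ← cdf]
      simp [concentrate, Nat.lt_succ_of_le hk, show k ≠ 0 by omega]
    have h2 : cdf f (k + 1) = cdf f k + f (k + 1) := by
      rw [cdf, Finset.sum_range_succ, ← cdf]
    rw [h1, h2]
    linarith

/-- The scale cancels, leaving an atom that tends to 1 as `K → ∞` when `μ` is the mean of `f`. -/
lemma sizeBiased_concentrate_one (hf : IsDensity f) {K : ℕ} (hK : cdf f K < 1) (hK1 : 1 ≤ K)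
    (μ : ℝ) :
    sizeBiased (concentrate f K) (concentrateScale f K * μ) 1 = partialMean f K / μ := by
  simp only [sizeBiased, concentrate, not_lt.2 hK1, if_false, if_true, zero_add, Nat.cast_one,
    one_mul]
  exact mul_div_mul_left _ _ (concentrateScale_pos hf hK).ne'

lemma tendsto_partialMean {μ : ℝ} (hμ : HasSum (fun k : ℕ => (k : ℝ) * f k) μ) :
    Tendsto (partialMean f) atTop (𝓝 μ) :=
  hμ.tendsto_sum_nat.comp (tendsto_add_atTop_nat 1)

lemma mean_pos (hf : IsDensity f) (h0 : cdf f 0 < 1) {μ : ℝ}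
    (hμ : HasSum (fun k : ℕ => (k : ℝ) * f k) μ) : 0 < μ := by
  have hnn : ∀ k : ℕ, 0 ≤ (k : ℝ) * f k := fun k => mul_nonneg k.cast_nonneg (hf.nonneg k)
  refine (hμ.nonneg hnn).lt_of_ne' fun hzero => ?_
  rw [hzero, hasSum_zero_iff_of_nonneg hnn] at hμ
  have hz : ∀ k, k ≠ 0 → f k = 0 := fun k hk => by
    simpa [hk] using congrFun hμ k
  have := (hasSum_single 0 hz).unique hf.hasSum_one
  simp [cdf, this] at h0

end

end DegreeCorrelation

theorem mainTheorem4 (f : ℕ → ℝ) (μ η : ℝ) (hη : 0 < η)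
    (hf : DegreeCorrelation.IsDensity f)
    (hμ : HasSum (fun k : ℕ => (k : ℝ) * f k) μ)
    (hmoment : Summable fun k : ℕ => (k : ℝ) ^ (1 + η) * f k)
    (hsupp : ∀ k, DegreeCorrelation.cdf f k < 1)
    (ρ : ℝ) (hρ₁ : -1 < ρ) (hρ₀ : ρ < 0) :
    ∃ (fρ : ℕ → ℝ) (μρ : ℝ),
      DegreeCorrelation.IsDensity fρ ∧
      HasSum (fun k : ℕ => (k : ℝ) * fρ k) μρ ∧
      0 < μρ ∧
      (Summable fun k : ℕ => (k : ℝ) ^ (1 + η) * fρ k) ∧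
      Tendsto (fun k => (1 - DegreeCorrelation.cdf fρ k) / (1 - DegreeCorrelation.cdf f k))
        atTop (𝓝 (μρ / μ)) ∧
      ∀ (ε : ℝ), 0 < ε →
      ∀ (S : ℕ → Type*) [∀ n, MeasurableSpace (S n)]
        (P : ∀ n, Measure (S n)) [∀ n, IsProbabilityMeasure (P n)]
        (G : ∀ n, S n → DegreeCorrelation.Multigraph n), (∀ n, Measurable (G n)) →
        DegreeCorrelation.InGraphClass η ε fρ (DegreeCorrelation.sizeBiased fρ μρ) P G →
        ∃ C : ℝ, ∀ᶠ n : ℕ in atTop,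
          (P n).real {s | ρ < (G n s).spearman} ≥
            1 - C * ((n : ℝ) ^ (-1 + min ε (1 / 2)) + (n : ℝ) ^ (-ε + 3 * min ε (1 / 2) / 4) +
              (P n).real (DegreeCorrelation.closeEvent ε fρ (DegreeCorrelation.sizeBiased fρ μρ)
                (fun s => (G n s).degree))ᶜ) := by
  have hμpos : 0 < μ := DegreeCorrelation.mean_pos hf (hsupp 0) hμ
  -- The cube tends to 1, which exceeds `1 + ρ` because `ρ < 0`. With `1 ≤ K`, the original mass at
  -- 1 is removed before the new atom is added.
  obtain ⟨K, hK, hK1⟩ : ∃ K, 1 + ρ < (DegreeCorrelation.partialMean f K / μ) ^ 3 ∧ 1 ≤ K := by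
    have hlim := ((DegreeCorrelation.tendsto_partialMean hμ).div_const μ).pow 3
    rw [div_self hμpos.ne'] at hlim
    exact ((hlim.eventually (lt_mem_nhds (by linarith))).and (eventually_ge_atTop 1)).exists
  have hc := DegreeCorrelation.concentrateScale_pos hf (hsupp K)
  refine ⟨DegreeCorrelation.concentrate f K, DegreeCorrelation.concentrateScale f K * μ, DegreeCorrelation.isDensity_concentrate hf (hsupp K),
    DegreeCorrelation.hasSum_mul_concentrate hμ K, mul_pos hc hμpos, DegreeCorrelation.summable_rpow_mul_concentrate hmoment K, ?_, ?_⟩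
  · rw [mul_div_cancel_right₀ _ hμpos.ne']
    refine tendsto_const_nhds.congr' ?_
    filter_upwards [eventually_ge_atTop K] with k hk
    rw [DegreeCorrelation.one_sub_cdf_concentrate hf (hsupp K) hK1 hk,
      mul_div_cancel_right₀ _ (sub_pos.2 (hsupp k)).ne']
  · intro ε hε S _ P _ G _ _
    rw [← DegreeCorrelation.sizeBiased_concentrate_one hf (hsupp K) hK1] at hK
    -- The failure probability is at most that of `Ω_nᶜ`, so the two powers of `n` enter only
    -- through being nonnegative.
    refine ⟨1, ?_⟩
    filter_upwards [DegreeCorrelation.eventually_lt_spearman_of_isClose (f := DegreeCorrelation.concentrate f K) hε hρ₁ hK] with n hn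
    set A := {s | ρ < (G n s).spearman}
    set B := DegreeCorrelation.closeEvent ε (DegreeCorrelation.concentrate f K)
      (DegreeCorrelation.sizeBiased (DegreeCorrelation.concentrate f K) (DegreeCorrelation.concentrateScale f K * μ)) (fun s => (G n s).degree)
    have hsub : Aᶜ ⊆ Bᶜ := Set.compl_subset_compl.2 fun s hs => hn (G n s) hs
    -- Subadditivity suffices here, so measurability of `A` plays no role.
    have hone : 1 ≤ (P n).real A + (P n).real Aᶜ := by
      simpa using measureReal_union_le (μ := P n) A Aᶜ
    have hmono : (P n).real Aᶜ ≤ (P n).real Bᶜ := measureReal_mono hsub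
    have h1 : 0 ≤ (n : ℝ) ^ (-1 + min ε (1 / 2)) := by positivity
    have h2 : 0 ≤ (n : ℝ) ^ (-ε + 3 * min ε (1 / 2) / 4) := by positivity
    linarith
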